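/- Call a function $f : \mathbb{Z}[i] \to \mathbb{Z}_{\ge 0}$ a Euclidean function if for all $a, b \in \mathbb{Z}[i]$ with $b \neq 0$ there exist $q, r \in \mathbb{Z}[i]$ such that $a = qb + r$ and either $r = 0$ or $f(r) < f(b)$ (no condition is imposed on $f(0)$). Let $\phi_{\mathbb{Z}[i]}$ be the minimal Euclidean function on the Gaussian integers, that is, $$\phi_{\mathbb{Z}[i]}(x) = \min\{ f(x) : f \text{ is a Euclidean function on } \mathbb{Z}[i] \} \qquad (x \in \mathbb{Z}[i]);$$ in particular $\phi_{\mathbb{Z}[i]}(0) = 0$. **Theorem.** For every integer $k \geq 1$, the set $\phi_{\mathbb{Z}[i]}^{-1}([0,2k]) = \{x \in \mathbb{Z}[i] : \phi_{\mathbb{Z}[i]}(x) \le 2k\}$ is finite and $$\left|\phi_{\mathbb{Z}[i]}^{-1}([0,2k])\right| = 25 + 8k - 48\cdot 2^k + 28\cdot 4^k.$$ -/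

import Mathlib

/-- A Euclidean function on a commutative ring `R`: every `a` can be divided by every nonzero `b`,
with a remainder that is zero or has a strictly smaller value than `b`.
The value at `0` is unconstrained. -/
def IsEuclideanFunction (R : Type*) [CommRing R] (f : R → ℕ) : Prop :=
  ∀ a b : R, b ≠ 0 → ∃ q r : R, a = q * b + r ∧ (r = 0 ∨ f r < f b)

/-- The minimal Euclidean function of `R`: the pointwise minimum over all Euclidean functions
on `R`. (As values at `0` are unconstrained, it vanishes at `0`.) -/
noncomputable def minimalEuclideanFunction (R : Type*) [CommRing R] (x : R) : ℕ :=
  sInf {n : ℕ | ∃ f : R → ℕ, IsEuclideanFunction R f ∧ f x = n}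

/-- If `R` has some Euclidean function, then `minimalEuclideanFunction R` is itself a Euclidean
function, and the least one for the pointwise order. -/
theorem isLeast_minimalEuclideanFunction (R : Type*) [CommRing R] (g : R → ℕ)
    (hg : IsEuclideanFunction R g) :
    IsLeast {f : R → ℕ | IsEuclideanFunction R f} (minimalEuclideanFunction R) := by
  have hle : ∀ f : R → ℕ, IsEuclideanFunction R f → ∀ x, minimalEuclideanFunction R x ≤ f x :=
    fun f hf x => Nat.sInf_le ⟨f, hf, rfl⟩
  refine ⟨?_, fun f hf x => hle f hf x⟩
  intro a b hb
  obtain ⟨f, hf, hfb⟩ : ∃ f : R → ℕ, IsEuclideanFunction R f ∧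
      f b = minimalEuclideanFunction R b :=
    Nat.sInf_mem (s := {n : ℕ | ∃ f : R → ℕ, IsEuclideanFunction R f ∧ f b = n}) ⟨g b, g, hg, rfl⟩
  obtain ⟨q, r, h, hr⟩ := hf a b hb
  exact ⟨q, r, h, hr.imp id fun hlt => lt_of_le_of_lt (hle f hf r) (hfb ▸ hlt)⟩

/-- The absolute norm is a Euclidean function on the Gaussian integers. -/
theorem isEuclideanFunction_norm_gaussianInt :
    IsEuclideanFunction GaussianInt (fun x => x.norm.natAbs) := fun a b hb =>
  ⟨a / b, a % b, by rw [mul_comm]; exact (EuclideanDomain.div_add_mod a b).symm,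
    Or.inr (GaussianInt.natAbs_norm_mod_lt a hb)⟩

/-! By Motzkin's criterion, a nonzero `x` has minimal value at most `n` exactly when every class
modulo `x` contains zero or an element of value less than `n`. The proof makes these sets explicit.
For nonzero `x = a + bi`, let `t` be the largest power of two dividing `x`; then `ball n` asks that
`max |a| |b| ≤ p + q - 2t` and `|a| + |b| ≤ 2p + q - 3t`, where `(p, q)` runs through (1,1), (1,2),
(2,2), (2,4), ... The step from `(p, q)` to `(q, 2p)` turns the octagon by 45 degrees and stretches
it, as multiplication by `1 + i` does. The elements of value at most `n` are then zero and `ball (n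
+ 1)`.

Upper bound (`reduces_of_ball`): modulo `x` in `ball (n + 1)` every class meets `ball n` or contains
zero. Digit expansion in base `1 + i` brings the dividend into `ball (n + 1)`. If dividend and
divisor are both divisible by `1 + i`, cancelling it lowers the level; otherwise subtracting `x`,
`ix` or `(1 ± i)x` suffices, by linear inequalities in octants.

Lower bound (`IsEuclideanFunction.ball_succ`): some `z` has `z - r` in `ball (n + 1)` for all `r` in
`ball n` and for `r = 0`. If the class of `z` modulo `x` contains such an `r`, then `x` divides `z -
r`, and `ball (n + 1)` is closed under taking divisors (`Inside.of_mul`).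

Count (`card_zero_or_inside`): the even-index values correspond to `(p, q) = (2^k, 2 * 2^k)`.
Multiples of 2 are twice the preceding such set; the other elements fill an octagon, whose lattice
points are counted directly. -/

/-! ### Octagons and linear inequalities in octants -/

/-- Membership of `(a, b)` in the octagon cut out by `max |a| |b| ≤ m` and `|a| + |b| ≤ s`. -/
def Oct (m s a b : ℤ) : Prop := |a| ≤ m ∧ |b| ≤ m ∧ |a| + |b| ≤ s

theorem lt_of_not_oct {m s a b : ℤ} (h : ¬ Oct m s a b) :
    m < a ∨ m < -a ∨ m < b ∨ m < -b ∨ s < a + b ∨ s < a - b ∨ s < -a + b ∨ s < -a - b := by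
  contrapose! h
  refine ⟨?_, ?_, ?_⟩ <;> rcases abs_cases a with h' | h' <;> rcases abs_cases b with h'' | h'' <;>
    omega

/-- The complement of a star-shaped neighbourhood of the origin that lies inside the octagon. -/
def Outer (p q a b : ℤ) : Prop := |a| + q ≤ |b| ∨ |b| + q ≤ |a| ∨ p ≤ |a| ∧ p ≤ |b|

theorem Outer.cases {p q a b : ℤ} (h : Outer p q a b) :
    a + q ≤ b ∧ -a + q ≤ b ∨ a + q ≤ -b ∧ -a + q ≤ -b ∨
    b + q ≤ a ∧ -b + q ≤ a ∨ b + q ≤ -a ∧ -b + q ≤ -a ∨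
    p ≤ a ∧ p ≤ b ∨ p ≤ a ∧ p ≤ -b ∨ p ≤ -a ∧ p ≤ b ∨ p ≤ -a ∧ p ≤ -b := by
  unfold Outer at h
  rcases abs_cases a with h' | h' <;> rcases abs_cases b with h'' | h'' <;>
    omega

/-- Points `(a, b)` with `0 ≤ b ≤ a` of the larger octagon that are far from the origin. -/
structure Octant (p q a b : ℤ) : Prop where
  nonneg : 0 ≤ b
  le : b ≤ a
  max_le : a + 2 ≤ q + 2 * p
  sum_le : a + b + 3 ≤ 2 * (q + p)
  outer : q + b ≤ a ∨ p ≤ b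

set_option maxHeartbeats 1000000 in
/-- Points of different parity, dividend odd, in the same octant. -/
theorem Octant.oct_sub_of_odd_even {p q a b c d : ℤ}
    (hq : q = p ∨ q = 2 * p) (hp : Odd p → p = 1)
    (hy : Octant p q a b) (hx : Octant p q c d) (hodd : (a + b) % 2 = 1) (hodd' : (c + d) % 2 = 0) :
    Oct (p + q - 2) (2 * p + q - 3) (a - c) (b - d) := by
  by_contra n1
  obtain ⟨ha1, ha2, ha3, ha4, ha5⟩ := hy
  obtain ⟨hc1, hc2, hc3, hc4, hc5⟩ := hx
  rcases hq with rfl | rfl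
  all_goals
  rcases lt_of_not_oct n1 with h1 | h1 | h1 | h1 | h1 | h1 | h1 | h1
  all_goals try omega
  all_goals
  -- The only violation not yet excluded has `q = p`, `a = 3q - 2`, `b = 0` and `c = d`. Since `a +
  -- b` is odd, so is `q`; then `q = 1`, which leaves no room for the divisor.
  have h : Odd q := by rw [Int.odd_iff]; omega
  have := hp h
  omega

set_option maxHeartbeats 1000000 in
/-- Dividend odd, divisor even, in opposite octants. -/
theorem Octant.oct_sub_of_odd_even_opposite {p q a b c d : ℤ}
    (hq : q = p ∨ q = 2 * p) (hp : Odd p → p = 1)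
    (hy : Octant p q a b) (hx : Octant p q c d) (hodd : (a + b) % 2 = 1) (hodd' : (c + d) % 2 = 0)
    (n1 : ¬ Oct (p + q - 2) (2 * p + q - 3) (a - c) (b + d))
    (n2 : ¬ Oct (p + q - 2) (2 * p + q - 3) (a - d) (b - c)) :
    Oct (p + q - 2) (2 * p + q - 3) (a - c - d) (b + d - c) := by
  by_contra n3
  obtain ⟨ha1, ha2, ha3, ha4, ha5⟩ := hy
  obtain ⟨hc1, hc2, hc3, hc4, hc5⟩ := hx
  rcases hq with rfl | rfl
  all_goals
  rcases lt_of_not_oct n1 with h1 | h1 | h1 | h1 | h1 | h1 | h1 | h1 <;> try omega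
  all_goals
  rcases lt_of_not_oct n2 with h2 | h2 | h2 | h2 | h2 | h2 | h2 | h2 <;> try omega
  all_goals
  rcases lt_of_not_oct n3 with h3 | h3 | h3 | h3 | h3 | h3 | h3 | h3 <;> try omega
  all_goals
  have h : Odd q := by rw [Int.odd_iff]; omega
  have := hp h
  omega

set_option maxHeartbeats 1000000 in
/-- Dividend even, divisor odd, in opposite octants. -/
theorem Octant.not_outer_sub_of_even_odd {p q a b c d : ℤ}
    (hq : q = p ∨ q = 2 * p) (hp : Odd p → p = 1)
    (hy : Octant p q a b) (hx : Octant p q c d) (hodd : (a + b) % 2 = 0) (hodd' : (c + d) % 2 = 1)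
    (n1 : ¬ Oct (p + q - 2) (2 * p + q - 3) (a - c) (b + d))
    (n2 : ¬ Oct (p + q - 2) (2 * p + q - 3) (a - d) (b - c)) :
    ¬ Outer p q (a - c - d) (b + d - c) := by
  intro n3
  obtain ⟨ha1, ha2, ha3, ha4, ha5⟩ := hy
  obtain ⟨hc1, hc2, hc3, hc4, hc5⟩ := hx
  rcases hq with rfl | rfl
  all_goals
  rcases lt_of_not_oct n1 with h1 | h1 | h1 | h1 | h1 | h1 | h1 | h1 <;> try omega
  all_goals
  rcases lt_of_not_oct n2 with h2 | h2 | h2 | h2 | h2 | h2 | h2 | h2 <;> try omega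
  all_goals
  rcases n3.cases with h3 | h3 | h3 | h3 | h3 | h3 | h3 | h3 <;> try omega
  all_goals
  have h : Odd q := by rw [Int.odd_iff]; omega
  have := hp h
  omega

set_option maxHeartbeats 1000000 in
/-- Dividend and divisor odd, in the same octant. -/
theorem Octant.oct_sub_of_odd_odd {p q a b c d : ℤ}
    (hq : q = p ∨ q = 2 * p) (hp : Odd p → p = 1)
    (hy : Octant p q a b) (hx : Octant p q c d) (hodd : (a + b) % 2 = 1) (hodd' : (c + d) % 2 = 1)
    (hy' : ¬ Oct (p + q - 2) (2 * p + q - 3) a b)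
    (n1 : Outer p q (a - c) (b - d))
    (n2 : ¬ Oct (p + q - 2) (2 * p + q - 3) (a - c + d) (b - d - c)) :
    Oct (p + q - 2) (2 * p + q - 3) (a - c - d) (b - d + c) := by
  by_contra n3
  obtain ⟨ha1, ha2, ha3, ha4, ha5⟩ := hy
  obtain ⟨hc1, hc2, hc3, hc4, hc5⟩ := hx
  replace hy' : p + q - 2 < a ∨ 2 * p + q - 3 < a + b := by
    rcases lt_of_not_oct hy' with h | h | h | h | h | h | h | h <;> omega
  rcases hq with rfl | rfl
  all_goals
  rcases n1.cases with h1 | h1 | h1 | h1 | h1 | h1 | h1 | h1 <;> try omega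
  all_goals
  rcases lt_of_not_oct n2 with h2 | h2 | h2 | h2 | h2 | h2 | h2 | h2 <;> try omega
  all_goals
  rcases lt_of_not_oct n3 with h3 | h3 | h3 | h3 | h3 | h3 | h3 | h3 <;> try omega
  all_goals
  have hp' : q = 1 ∨ q % 2 = 0 := by
    rcases Int.even_or_odd q with h | h
    · exact Or.inr (Int.even_iff.1 h)
    · exact Or.inl (hp h)
  rcases hp' with hp' | hp' <;> omega

set_option maxHeartbeats 1000000 in
/-- Dividend and divisor odd, in opposite octants. -/
theorem Octant.oct_sub_of_odd_odd_opposite {p q a b c d : ℤ}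
    (hq : q = p ∨ q = 2 * p) (hp : Odd p → p = 1)
    (hy : Octant p q a b) (hx : Octant p q c d) (hodd : (a + b) % 2 = 1) (hodd' : (c + d) % 2 = 1)
    (hy' : ¬ Oct (p + q - 2) (2 * p + q - 3) a b)
    (n1 : Outer p q (a - c) (b + d)) (n2 : Outer p q (a - d) (b - c)) :
    Oct (p + q - 2) (2 * p + q - 3) (a - c - d) (b + d - c) := by
  by_contra n3
  obtain ⟨ha1, ha2, ha3, ha4, ha5⟩ := hy
  obtain ⟨hc1, hc2, hc3, hc4, hc5⟩ := hx
  replace hy' : p + q - 2 < a ∨ 2 * p + q - 3 < a + b := by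
    rcases lt_of_not_oct hy' with h | h | h | h | h | h | h | h <;> omega
  rcases hq with rfl | rfl
  all_goals
  rcases n1.cases with h1 | h1 | h1 | h1 | h1 | h1 | h1 | h1 <;> try omega
  all_goals
  rcases n2.cases with h2 | h2 | h2 | h2 | h2 | h2 | h2 | h2 <;> try omega
  all_goals
  rcases lt_of_not_oct n3 with h3 | h3 | h3 | h3 | h3 | h3 | h3 | h3 <;> try omega
  all_goals
  have hp' : q = 1 ∨ q % 2 = 0 := by
    rcases Int.even_or_odd q with h | h
    · exact Or.inr (Int.even_iff.1 h)
    · exact Or.inl (hp h)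
  rcases hp' with hp' | hp' <;> omega

/-! ### The sets `Inside p q`: shape and closure under divisors -/

/-- The Gaussian integers `x ≠ 0` in the octagon of `p` and `q`, where the octagon shrinks with the
largest power of two dividing `x`. -/
def Inside (p q : ℤ) (x : GaussianInt) : Prop :=
  ∃ j : ℕ, ¬ (((2 ^ (j + 1) : ℤ) : GaussianInt) ∣ x) ∧
    Oct (p + q - 2 * 2 ^ j) (2 * p + q - 3 * 2 ^ j) x.re x.im

/-- The parameters that occur for the minimal Euclidean function. -/
def IsLevel (p q : ℤ) : Prop := ∃ k : ℕ, p = 2 ^ k ∧ (q = p ∨ q = 2 * p)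

theorem IsLevel.pos {p q : ℤ} (h : IsLevel p q) : 0 < p := by
  obtain ⟨k, rfl, -⟩ := h
  positivity

theorem IsLevel.eq_or {p q : ℤ} (h : IsLevel p q) : q = p ∨ q = 2 * p := by
  obtain ⟨k, -, h⟩ := h
  exact h

theorem IsLevel.eq_one_of_odd {p q : ℤ} (h : IsLevel p q) (hp : Odd p) : p = 1 := by
  obtain ⟨k, rfl, -⟩ := h
  rcases k with _ | k
  · simp
  · exact absurd hp (by rw [pow_succ']; simp)

theorem IsLevel.next {p q : ℤ} (h : IsLevel p q) : IsLevel q (2 * p) := by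
  obtain ⟨k, rfl, rfl | rfl⟩ := h
  · exact ⟨k, rfl, Or.inr rfl⟩
  · exact ⟨k + 1, by ring, Or.inl rfl⟩

/-- Powers of two are comparable by divisibility. -/
theorem IsLevel.pow_two_cases {p q : ℤ} (h : IsLevel p q) (j : ℕ) :
    (∃ m, p = 2 ^ j * (2 * m)) ∨ p = 2 ^ j ∨ ∃ m, 0 < m ∧ (2 : ℤ) ^ j = 2 * p * m := by
  obtain ⟨k, rfl, -⟩ := h
  rcases lt_trichotomy j k with hjk | rfl | hjk
  · obtain ⟨i, rfl⟩ := Nat.exists_eq_add_of_lt hjk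
    exact Or.inl ⟨2 ^ i, by ring⟩
  · exact Or.inr (Or.inl rfl)
  · obtain ⟨i, rfl⟩ := Nat.exists_eq_add_of_lt hjk
    exact Or.inr (Or.inr ⟨2 ^ i, by positivity, by ring⟩)

theorem Oct.neg {m s a b : ℤ} (h : Oct m s a b) : Oct m s (-a) (-b) := by
  simpa [Oct] using h

theorem Oct.mono {m m' s s' a b : ℤ} (h : Oct m s a b) (hm : m ≤ m') (hs : s ≤ s') :
    Oct m' s' a b :=
  ⟨h.1.trans hm, h.2.1.trans hm, h.2.2.trans hs⟩

theorem Inside.ne_zero {p q : ℤ} {x : GaussianInt} (h : Inside p q x) : x ≠ 0 := by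
  rintro rfl
  obtain ⟨j, hj, -⟩ := h
  exact hj (dvd_zero _)

theorem Inside.mono {p q p' q' : ℤ} {x : GaussianInt} (h : Inside p q x) (h1 : p + q ≤ p' + q')
    (h2 : 2 * p + q ≤ 2 * p' + q') : Inside p' q' x := by
  obtain ⟨j, hj, ho⟩ := h
  exact ⟨j, hj, ho.mono (by linarith) (by linarith)⟩

theorem IsLevel.inside_next {p q : ℤ} (h : IsLevel p q) {x : GaussianInt} (hx : Inside p q x) :
    Inside q (2 * p) x := by
  have := h.pos
  rcases h.eq_or with rfl | rfl <;> exact hx.mono (by linarith) (by linarith)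

/-- Units only permute the coordinates up to sign. Otherwise `z` has norm at least 2, so the norm of
`x` is at most half that of `x * z`, which is at most `2 * m ^ 2` and at most `s ^ 2`. Hence the
norm of `x` is at most `m ^ 2`, and `(|a| + |b|) ^ 2` is at most twice that norm, hence at most `s ^
2`. -/
theorem Oct.of_mul {m s : ℤ} {x z : GaussianInt} (h : Oct m s (x * z).re (x * z).im)
    (hz : z ≠ 0) : Oct m s x.re x.im := by
  have hN : (1 : ℤ) ≤ z.re ^ 2 + z.im ^ 2 := by
    by_contra hcon
    have h1 : z.re = 0 := by nlinarith [sq_nonneg z.re, sq_nonneg z.im]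
    have h2 : z.im = 0 := by nlinarith [sq_nonneg z.re, sq_nonneg z.im]
    exact hz (Zsqrtd.ext h1 h2)
  obtain ⟨a, b⟩ := x
  obtain ⟨c, d⟩ := z
  simp only [Zsqrtd.re_mul, Zsqrtd.im_mul] at h hN ⊢
  obtain ⟨h1, h2, h3⟩ := h
  rcases hN.eq_or_lt with hN | hN
  · have hcd : c = 0 ∧ (d = 1 ∨ d = -1) ∨ d = 0 ∧ (c = 1 ∨ c = -1) := by
      clear hz h1 h2 h3
      have hc : -1 ≤ c ∧ c ≤ 1 := by constructor <;> nlinarith [sq_nonneg d]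
      have hd : -1 ≤ d ∧ d ≤ 1 := by constructor <;> nlinarith [sq_nonneg c]
      obtain ⟨hc1, hc2⟩ := hc
      obtain ⟨hd1, hd2⟩ := hd
      interval_cases c <;> interval_cases d <;> omega
    rcases hcd with ⟨rfl, rfl | rfl⟩ | ⟨rfl, rfl | rfl⟩ <;>
      simp [abs_neg] at h1 h2 h3 <;> refine ⟨?_, ?_, ?_⟩ <;> linarith
  · have hm : 0 ≤ m := (abs_nonneg _).trans h1
    have hs : 0 ≤ s := by
      linarith [abs_nonneg (a * c + -1 * b * d), abs_nonneg (a * d + b * c)]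
    have hmul : (a * c + -1 * b * d) ^ 2 + (a * d + b * c) ^ 2 =
        (a ^ 2 + b ^ 2) * (c ^ 2 + d ^ 2) := by ring
    have hge : 2 * (a ^ 2 + b ^ 2) ≤ (a * c + -1 * b * d) ^ 2 + (a * d + b * c) ^ 2 := by
      rw [hmul]; nlinarith [sq_nonneg a, sq_nonneg b]
    have hA : (a * c + -1 * b * d) ^ 2 ≤ m ^ 2 := sq_le_sq' (abs_le.1 h1).1 (abs_le.1 h1).2
    have hB : (a * d + b * c) ^ 2 ≤ m ^ 2 := sq_le_sq' (abs_le.1 h2).1 (abs_le.1 h2).2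
    refine ⟨abs_le_of_sq_le_sq (by nlinarith [sq_nonneg b]) hm,
      abs_le_of_sq_le_sq (by nlinarith [sq_nonneg a]) hm, ?_⟩
    have hS : (a * c + -1 * b * d) ^ 2 + (a * d + b * c) ^ 2 ≤ s ^ 2 := by
      rw [← sq_abs (a * c + -1 * b * d), ← sq_abs (a * d + b * c)]
      nlinarith [abs_nonneg (a * c + -1 * b * d), abs_nonneg (a * d + b * c)]
    refine le_of_sq_le_sq ?_ hs
    nlinarith [sq_nonneg (|a| - |b|), sq_abs a, sq_abs b]

theorem Inside.of_mul {p q : ℤ} {x z : GaussianInt} (h : Inside p q (x * z)) : Inside p q x := by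
  have hz : z ≠ 0 := fun hz => h.ne_zero (by rw [hz, mul_zero])
  obtain ⟨j, hj, ho⟩ := h
  -- The same `j` serves, because `Inside` does not require `2 ^ j` to divide the element.
  exact ⟨j, fun hd => hj (hd.mul_right z), ho.of_mul hz⟩

theorem inside_star {p q : ℤ} {x : GaussianInt} (h : Inside p q x) : Inside p q (star x) := by
  obtain ⟨j, hj, ho⟩ := h
  refine ⟨j, ?_, ?_⟩
  · rw [Zsqrtd.intCast_dvd] at hj ⊢
    simpa using hj
  · simpa [Oct] using ho

/-- The exact power of two dividing a nonzero Gaussian integer. -/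
theorem exists_pow_two_dvd {x : GaussianInt} (hx : x ≠ 0) :
    ∃ j : ℕ, ((2 ^ j : ℤ) : GaussianInt) ∣ x ∧ ¬ (((2 ^ (j + 1) : ℤ) : GaussianInt) ∣ x) := by
  have hex : ∃ j : ℕ, ¬ (((2 ^ (j + 1) : ℤ) : GaussianInt) ∣ x) := by
    refine ⟨(|x.re| + |x.im|).toNat, fun h => hx ?_⟩
    rw [Zsqrtd.intCast_dvd] at h
    have hlt : |x.re| + |x.im| < 2 ^ ((|x.re| + |x.im|).toNat + 1) := by
      have := Nat.lt_two_pow_self (n := (|x.re| + |x.im|).toNat)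
      have h2 : ((|x.re| + |x.im|).toNat : ℤ) < 2 ^ (|x.re| + |x.im|).toNat := by
        exact_mod_cast this
      rw [Int.toNat_of_nonneg (by positivity)] at h2
      rw [pow_succ]
      have : (0 : ℤ) < 2 ^ (|x.re| + |x.im|).toNat := by positivity
      linarith
    exact Zsqrtd.ext
      (Int.eq_zero_of_abs_lt_dvd h.1 (by linarith [abs_nonneg x.im]))
      (Int.eq_zero_of_abs_lt_dvd h.2 (by linarith [abs_nonneg x.re]))
  classical
  refine ⟨Nat.find hex, ?_, Nat.find_spec hex⟩
  rcases hj : Nat.find hex with _ | i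
  · simp
  · by_contra hcon
    exact Nat.find_min hex (m := i) (by omega) hcon

theorem lt_abs_of_not_oct {m s a b : ℤ} (h : ¬ Oct m s a b) :
    m < |a| ∨ m < |b| ∨ s < |a| + |b| := by
  by_contra! hcon
  exact h hcon

/-- Let `t` be the exact power of two in `x`. If `t` divides `p`, all quantities are multiples of
`t`, so strict bounds improve by `t`: a smaller coordinate below `p` and a difference below `q`
bound the larger coordinate by `p + q - 2t` and the sum by `2p + q - 3t`. If `t` does not divide
`p`, nonzero coordinates are at least `2p ≥ q` in size and `Outer` is automatic. -/
theorem IsLevel.outer_of_not_inside {p q : ℤ} (h : IsLevel p q) {x : GaussianInt} (hx : x ≠ 0)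
    (hn : ¬ Inside p q x) : Outer p q x.re x.im := by
  obtain ⟨j, hj, hj'⟩ := exists_pow_two_dvd hx
  have hno : ¬ Oct (p + q - 2 * 2 ^ j) (2 * p + q - 3 * 2 ^ j) x.re x.im :=
    fun ho => hn ⟨j, hj', ho⟩
  rw [Zsqrtd.intCast_dvd] at hj
  have hab : |x.re| ≠ 0 ∨ |x.im| ≠ 0 := by
    by_contra! hcon
    exact hx (Zsqrtd.ext (abs_eq_zero.1 hcon.1) (abs_eq_zero.1 hcon.2))
  obtain ⟨a, ha⟩ := (dvd_abs _ _).2 hj.1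
  obtain ⟨b, hb⟩ := (dvd_abs _ _).2 hj.2
  have hno' := lt_abs_of_not_oct hno
  unfold Outer
  have hp := h.pos
  have hA := abs_nonneg x.re
  have hB := abs_nonneg x.im
  generalize |x.re| = A at *
  generalize |x.im| = B at *
  have ht : (0 : ℤ) < 2 ^ j := by positivity
  have hcase := h.pow_two_cases j
  have hq := h.eq_or
  generalize (2 : ℤ) ^ j = t at *
  subst ha hb
  have ha : 0 ≤ a := nonneg_of_mul_nonneg_right hA ht
  have hb : 0 ≤ b := nonneg_of_mul_nonneg_right hB ht
  obtain ⟨m, rfl⟩ | ⟨m, hm, rfl⟩ : (∃ m, p = t * m) ∨ ∃ m, 0 < m ∧ t = 2 * p * m := by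
    rcases hcase with ⟨m, rfl⟩ | rfl | h
    · exact Or.inl ⟨_, rfl⟩
    · exact Or.inl ⟨1, by ring⟩
    · exact Or.inr h
  · obtain ⟨n, rfl, hn⟩ : ∃ n, q = t * n ∧ (n = m ∨ n = 2 * m) := by
      rcases hq with rfl | rfl
      · exact ⟨m, rfl, Or.inl rfl⟩
      · exact ⟨2 * m, by ring, Or.inr rfl⟩
    have key : ∀ r s : ℤ, t * r ≤ t * s ↔ r ≤ s := fun r s => mul_le_mul_iff_right₀ ht
    have key' : ∀ r s : ℤ, t * r < t * s ↔ r < s := fun r s => mul_lt_mul_iff_right₀ ht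
    have hno'' : m + n - 2 < a ∨ m + n - 2 < b ∨ 2 * m + n - 3 < a + b := by
      exact hno'.imp (fun h => (key' _ _).1 (by linarith)) (Or.imp
        (fun h => (key' _ _).1 (by linarith)) (fun h => (key' _ _).1 (by linarith)))
    rw [← mul_add, ← mul_add, key, key, key, key]
    omega
  · have h2 : ∀ r : ℤ, r = 0 ∨ r < 0 ∨ q ≤ 2 * p * m * r ∧ p ≤ 2 * p * m * r := by
      intro r
      rcases lt_trichotomy r 0 with hr | hr | hr
      · exact Or.inr (Or.inl hr)
      · exact Or.inl hr
      · have : 2 * p ≤ 2 * p * m * r := by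
          have : 1 ≤ m * r := by nlinarith
          nlinarith
        exact Or.inr (Or.inr (by constructor <;> rcases hq with h | h <;> linarith))
    rcases h2 a with rfl | h | ⟨h, h'⟩
    · rcases h2 b with rfl | h | ⟨h, h'⟩
      · simp at hab
      · linarith
      · left; simpa using h
    · linarith
    · rcases h2 b with rfl | h1 | ⟨h1, h1'⟩
      · right; left; simpa using h
      · linarith
      · exact Or.inr (Or.inr ⟨h', h1'⟩)

/-! ### Multiplication by `1 + i` shifts the level -/

/-- The prime `1 + i` above two. -/
def onePlusI : GaussianInt := ⟨1, 1⟩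

theorem re_onePlusI_mul (x : GaussianInt) : (onePlusI * x).re = x.re - x.im := by
  simp [onePlusI, Zsqrtd.re_mul]; ring

theorem im_onePlusI_mul (x : GaussianInt) : (onePlusI * x).im = x.re + x.im := by
  simp [onePlusI, Zsqrtd.im_mul]; ring

theorem abs_sub_add_cases (a b : ℤ) :
    (|a - b| = |a| + |b| ∧ |a + b| = |a| - |b| ∧ |b| ≤ |a|) ∨
    (|a - b| = |a| + |b| ∧ |a + b| = |b| - |a| ∧ |a| ≤ |b|) ∨
    (|a + b| = |a| + |b| ∧ |a - b| = |a| - |b| ∧ |b| ≤ |a|) ∨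
    (|a + b| = |a| + |b| ∧ |a - b| = |b| - |a| ∧ |a| ≤ |b|) := by
  rcases abs_cases a with h1 | h1 <;> rcases abs_cases b with h2 | h2 <;>
    rcases abs_cases (a + b) with h3 | h3 <;> rcases abs_cases (a - b) with h4 | h4 <;> omega

/-- The larger of `|a - b|` and `|a + b|` is `|a| + |b|`, and their sum is `2 * max |a| |b|`: the
two kinds of sides of the octagon trade places. -/
theorem oct_onePlusI_mul {m s : ℤ} {x : GaussianInt} :
    Oct m s (onePlusI * x).re (onePlusI * x).im ↔
      |x.re| + |x.im| ≤ m ∧ 2 * |x.re| ≤ s ∧ 2 * |x.im| ≤ s := by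
  rw [re_onePlusI_mul, im_onePlusI_mul, Oct]
  have := abs_sub_add_cases x.re x.im
  have := abs_nonneg x.re
  have := abs_nonneg x.im
  omega

/-- If the product acquires no further factor 2, the turned octagon has room to spare. If it does,
`x` is `2 ^ j` times a point with both coordinates odd, and the parity of the bounds, as multiples
of `2 ^ j`, gains the extra `2 ^ j` that `j + 1` costs. -/
theorem IsLevel.inside_onePlusI_mul {p q : ℤ} (h : IsLevel p q) {x : GaussianInt}
    (hx : Inside p q x) : Inside q (2 * p) (onePlusI * x) := by
  obtain ⟨j, hj, h1, h2, h3⟩ := hx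
  have ht : (0 : ℤ) < 2 ^ j := by positivity
  by_cases hd : ((2 ^ (j + 1) : ℤ) : GaussianInt) ∣ onePlusI * x
  · refine ⟨j + 1, ?_, ?_⟩
    · intro hd'
      apply hj
      rw [Zsqrtd.intCast_dvd, re_onePlusI_mul, im_onePlusI_mul] at hd'
      rw [Zsqrtd.intCast_dvd]
      obtain ⟨⟨u, hu⟩, ⟨v, hv⟩⟩ := hd'
      rw [pow_succ] at hu hv
      exact ⟨⟨u + v, by linarith⟩, ⟨v - u, by linarith⟩⟩
    · rw [oct_onePlusI_mul]
      rw [Zsqrtd.intCast_dvd, re_onePlusI_mul, im_onePlusI_mul] at hd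
      rw [Zsqrtd.intCast_dvd] at hj
      obtain ⟨⟨u, hu⟩, ⟨v, hv⟩⟩ := hd
      have hcase := h.pow_two_cases j
      have hq := h.eq_or
      rw [pow_succ] at *
      generalize (2 : ℤ) ^ j = t at *
      have ha : x.re = t * (u + v) := by linarith
      have hb : x.im = t * (v - u) := by linarith
      have hodd : (u + v) % 2 = 1 := by
        by_contra hcon
        obtain ⟨w, hw⟩ : ∃ w, u + v = 2 * w := ⟨(u + v) / 2, by omega⟩
        exact hj ⟨⟨w, by rw [ha, hw]; ring⟩,
          ⟨w - u, by rw [hb, show v - u = 2 * (w - u) by linarith]; ring⟩⟩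
      simp only [ha, hb, abs_mul, abs_of_pos ht] at h1 h2 h3 ⊢
      have hodd' : |u + v| % 2 = 1 := by rcases abs_cases (u + v) with h | h <;> omega
      have hodd'' : |v - u| % 2 = 1 := by rcases abs_cases (v - u) with h | h <;> omega
      have hA := abs_nonneg (u + v)
      have hB := abs_nonneg (v - u)
      generalize |u + v| = A at *
      generalize |v - u| = B at *
      have key : ∀ r s : ℤ, t * r ≤ t * s ↔ r ≤ s := fun r s => mul_le_mul_iff_right₀ ht
      rcases hcase with ⟨m, rfl⟩ | rfl | ⟨m, hm, rfl⟩
      · obtain ⟨n, rfl, hn⟩ : ∃ n, q = t * (2 * n) ∧ (n = m ∨ n = 2 * m) := by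
          rcases hq with rfl | rfl
          · exact ⟨m, rfl, Or.inl rfl⟩
          · exact ⟨2 * m, by ring, Or.inr rfl⟩
        have e1 : A ≤ 2 * m + 2 * n - 2 := by rw [← key]; linarith
        have e2 : B ≤ 2 * m + 2 * n - 2 := by rw [← key]; linarith
        have e3 : A + B ≤ 4 * m + 2 * n - 3 := by rw [← key]; linarith
        have f1 : A ≤ 2 * m + 2 * n - 3 := by omega
        have f2 : B ≤ 2 * m + 2 * n - 3 := by omega
        have f3 : A + B ≤ 4 * m + 2 * n - 4 := by omega
        rw [← key] at f1 f2 f3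
        exact ⟨by linarith, by linarith, by linarith⟩
      -- When `2 ^ j` is at least `p`, the octagon is too small for two odd coordinates.
      · have e3 : A + B ≤ 1 := by
          rw [← key]
          rcases hq with rfl | rfl <;> linarith
        omega
      · have e3 : A + B ≤ 1 := by
          rw [← key]
          have : p ≤ p * m := by nlinarith [h.pos]
          rcases hq with rfl | rfl <;> linarith
        omega
  · exact ⟨j, hd, oct_onePlusI_mul.2 ⟨by linarith, by linarith, by linarith⟩⟩

/-- If `2 ^ j` divides `x`, the quotient has odd coordinate sum, and rounding by parity gives the
bounds for the same `j`. Otherwise `j - 1` is admissible, and its octagon is large enough. -/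
theorem IsLevel.inside_of_onePlusI_mul {p q : ℤ} (h : IsLevel p q) {x : GaussianInt}
    (hx : Inside q (2 * p) (onePlusI * x)) : Inside p q x := by
  obtain ⟨j, hj, ho⟩ := hx
  rw [oct_onePlusI_mul] at ho
  obtain ⟨h1, h2, h3⟩ := ho
  have ht : (0 : ℤ) < 2 ^ j := by positivity
  by_cases hd : ((2 ^ j : ℤ) : GaussianInt) ∣ x
  · refine ⟨j, fun hd => hj (hd.mul_left _), ?_⟩
    rw [Zsqrtd.intCast_dvd] at hd
    rw [Zsqrtd.intCast_dvd, re_onePlusI_mul, im_onePlusI_mul] at hj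
    obtain ⟨⟨a, ha⟩, ⟨b, hb⟩⟩ := hd
    have hcase := h.pow_two_cases j
    have hq := h.eq_or
    unfold Oct
    rw [pow_succ] at *
    generalize (2 : ℤ) ^ j = t at *
    have hodd : (a + b) % 2 = 1 := by
      by_contra hcon
      obtain ⟨w, hw⟩ : ∃ w, a + b = 2 * w := ⟨(a + b) / 2, by omega⟩
      obtain rfl : b = 2 * w - a := by linarith
      exact hj ⟨⟨a - w, by rw [ha, hb]; ring⟩, ⟨w, by rw [ha, hb]; ring⟩⟩
    simp only [ha, hb, abs_mul, abs_of_pos ht] at h1 h2 h3 ⊢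
    have hodd' : (|a| + |b|) % 2 = 1 := by
      rcases abs_cases a with h | h <;> rcases abs_cases b with h' | h' <;> omega
    have hA := abs_nonneg a
    have hB := abs_nonneg b
    generalize |a| = A at *
    generalize |b| = B at *
    have key : ∀ r s : ℤ, t * r ≤ t * s ↔ r ≤ s := fun r s => mul_le_mul_iff_right₀ ht
    have hp := h.pos
    rcases hcase with ⟨m, rfl⟩ | rfl | ⟨m, hm, rfl⟩
    · obtain ⟨n, rfl, hn⟩ : ∃ n, q = t * (2 * n) ∧ (n = m ∨ n = 2 * m) := by
        rcases hq with rfl | rfl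
        · exact ⟨m, rfl, Or.inl rfl⟩
        · exact ⟨2 * m, by ring, Or.inr rfl⟩
      have e1 : 2 * A ≤ 2 * (2 * m + 2 * n) - 3 := by rw [← key]; linarith
      have e2 : 2 * B ≤ 2 * (2 * m + 2 * n) - 3 := by rw [← key]; linarith
      have e3 : A + B ≤ 4 * m + 2 * n - 2 := by rw [← key]; linarith
      have f1 : A ≤ 2 * m + 2 * n - 2 := by omega
      have f2 : B ≤ 2 * m + 2 * n - 2 := by omega
      have f3 : A + B ≤ 4 * m + 2 * n - 3 := by omega
      rw [← key] at f1 f2 f3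
      exact ⟨by linarith, by linarith, by linarith⟩
    · rcases hq with rfl | rfl
      · have e1 : 2 * A ≤ 1 := by rw [← key]; linarith
        have e2 : 2 * B ≤ 1 := by rw [← key]; linarith
        omega
      · have e3 : A + B ≤ 2 := by rw [← key]; linarith
        have f1 : A ≤ 1 := by omega
        have f2 : B ≤ 1 := by omega
        have f3 : A + B ≤ 1 := by omega
        rw [← key] at f1 f2 f3
        exact ⟨by linarith, by linarith, by linarith⟩
    · have e3 : A + B ≤ 0 := by
        rw [← key]
        have : p ≤ p * m := by nlinarith
        rcases hq with rfl | rfl <;> linarith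
      omega
  · rcases j with _ | i
    · simp at hd
    · refine ⟨i, hd, ?_⟩
      rw [pow_succ] at *
      have : (0 : ℤ) < 2 ^ i := by positivity
      exact ⟨by linarith, by linarith, by linarith⟩

/-! ### Reduction by one level -/

/-- The class of `y` modulo `x` contains zero or an element of `Inside p q`. -/
def Reduces (p q : ℤ) (x y : GaussianInt) : Prop :=
  ∃ r, x ∣ y - r ∧ (r = 0 ∨ Inside p q r)

theorem Reduces.of_mul_left {p q : ℤ} {u x y : GaussianInt} (h : Reduces p q (u * x) y) :
    Reduces p q x y := by
  obtain ⟨r, hr, h⟩ := h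
  exact ⟨r, dvd_of_mul_left_dvd hr, h⟩

theorem Reduces.of_mul_unit {p q : ℤ} {u v x y : GaussianInt} (huv : u * v = 1)
    (h : Reduces p q x (u * y)) : Reduces p q x y := by
  obtain ⟨r, hr, h⟩ := h
  refine ⟨v * r, ?_, ?_⟩
  · have : y - v * r = v * (u * y - r) := by linear_combination (-y) * huv
    rw [this]
    exact hr.mul_left v
  · rcases h with rfl | h
    · exact Or.inl (mul_zero v)
    · refine Or.inr (Inside.of_mul (z := u) ?_)
      rwa [show v * r * u = r by linear_combination r * huv]

theorem Reduces.of_star {p q : ℤ} {x y : GaussianInt} (h : Reduces p q (star x) (star y)) :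
    Reduces p q x y := by
  obtain ⟨r, ⟨z, hz⟩, h⟩ := h
  refine ⟨star r, ⟨star z, ?_⟩, ?_⟩
  · have := congrArg star hz
    simpa [mul_comm] using this
  · rcases h with rfl | h
    · exact Or.inl (star_zero _)
    · exact Or.inr (inside_star h)

theorem inside_of_odd {p q : ℤ} {r : GaussianInt} (hodd : (r.re + r.im) % 2 = 1)
    (h : Oct (p + q - 2) (2 * p + q - 3) r.re r.im) : Inside p q r := by
  refine ⟨0, fun hd => ?_, by simpa using h⟩
  rw [Zsqrtd.intCast_dvd] at hd
  obtain ⟨⟨a, ha⟩, ⟨b, hb⟩⟩ := hd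
  omega

theorem Inside.oct {p q : ℤ} {r : GaussianInt} (h : Inside p q r) :
    Oct (p + q - 2) (2 * p + q - 3) r.re r.im := by
  obtain ⟨j, -, h⟩ := h
  have : (1 : ℤ) ≤ 2 ^ j := one_le_pow₀ (by norm_num)
  exact h.mono (by linarith) (by linarith)

theorem reduces_of_oct {p q a b : ℤ} {x y : GaussianInt} (z : GaussianInt)
    (ha : (y - z * x).re = a) (hb : (y - z * x).im = b) (hodd : (a + b) % 2 = 1)
    (h : Oct (p + q - 2) (2 * p + q - 3) a b) : Reduces p q x y := by
  subst ha hb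
  exact ⟨y - z * x, ⟨z, by ring⟩, Or.inr (inside_of_odd hodd h)⟩

/-- Meant for even remainders: these may contain an unknown power of two, so the largest octagon
does not decide membership. -/
theorem IsLevel.reduces_of_not_outer {p q a b : ℤ} (hl : IsLevel p q) {x y : GaussianInt}
    (z : GaussianInt) (ha : (y - z * x).re = a) (hb : (y - z * x).im = b) (h : ¬ Outer p q a b) :
    Reduces p q x y := by
  subst ha hb
  refine ⟨y - z * x, ⟨z, by ring⟩, ?_⟩
  by_contra! hcon
  exact h (hl.outer_of_not_inside hcon.1 hcon.2)

theorem IsLevel.octant {p q : ℤ} (hl : IsLevel p q) {x : GaussianInt} (hx : Inside q (2 * p) x)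
    (hn : ¬ Inside p q x) {b : ℤ} (hb : |x.im| = b) (hba : b ≤ x.re) : Octant p q x.re b := by
  have ho := hl.outer_of_not_inside hx.ne_zero hn
  obtain ⟨h1, h2, h3⟩ := hx.oct
  have h0 : 0 ≤ b := hb ▸ abs_nonneg _
  rw [Outer, hb, abs_of_nonneg (h0.trans hba)] at ho
  rw [abs_of_nonneg (h0.trans hba)] at h1 h3
  have hp := hl.pos
  exact ⟨h0, hba, by linarith, by linarith, by rcases hl.eq_or with rfl | rfl <;> omega⟩

theorem not_oct_of_odd {p q : ℤ} {x : GaussianInt} (hn : ¬ Inside p q x)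
    (hodd : (x.re + x.im) % 2 = 1) : ¬ Oct (p + q - 2) (2 * p + q - 3) x.re x.im :=
  fun h => hn (inside_of_odd hodd h)

/-- The geometric core: reduction of one level for a divisor and a dividend in fixed octants. -/
theorem IsLevel.reduces_of_octant {p q : ℤ} (hl : IsLevel p q) {x y : GaussianInt}
    (hx : Inside q (2 * p) x) (hx' : ¬ Inside p q x) (hxo : |x.im| ≤ x.re)
    (hy : Inside q (2 * p) y) (hy' : ¬ Inside p q y) (hy0 : 0 ≤ y.im) (hyo : y.im ≤ y.re)
    (hpar : (x.re + x.im) % 2 = 1 ∨ (y.re + y.im) % 2 = 1) : Reduces p q x y := by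
  have hoy := hl.octant hy hy' (abs_of_nonneg hy0) hyo
  have hq := hl.eq_or
  have hp := fun h => hl.eq_one_of_odd h
  have hno := not_oct_of_odd hy'
  have h1r : (y - 1 * x).re = y.re - x.re := by simp
  have h1i : (y - 1 * x).im = y.im - x.im := by simp
  have hpr : (y - ⟨1, 1⟩ * x).re = y.re - x.re + x.im := by simp [Zsqrtd.re_mul]; ring
  have hpi : (y - ⟨1, 1⟩ * x).im = y.im - x.im - x.re := by simp [Zsqrtd.im_mul]; ring
  have hmr : (y - ⟨1, -1⟩ * x).re = y.re - x.re - x.im := by simp [Zsqrtd.re_mul]; ring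
  have hmi : (y - ⟨1, -1⟩ * x).im = y.im - x.im + x.re := by simp [Zsqrtd.im_mul]; ring
  have hir : (y - ⟨0, 1⟩ * x).re = y.re + x.im := by simp [Zsqrtd.re_mul]
  have hii : (y - ⟨0, 1⟩ * x).im = y.im - x.re := by simp [Zsqrtd.im_mul]
  rcases le_total 0 x.im with hd | hd
  · have hox := hl.octant hx hx' (abs_of_nonneg hd) ((le_abs_self _).trans hxo)
    rcases Int.emod_two_eq_zero_or_one (x.re + x.im) with hxp | hxp
    · have hyp : (y.re + y.im) % 2 = 1 := by omega
      exact reduces_of_oct 1 h1r h1i (by omega) (hoy.oct_sub_of_odd_even hq hp hox hyp hxp)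
    rcases Int.emod_two_eq_zero_or_one (y.re + y.im) with hyp | hyp
    · have := (hox.oct_sub_of_odd_even hq hp hoy hxp hyp).neg
      rw [neg_sub, neg_sub] at this
      exact reduces_of_oct 1 h1r h1i (by omega) this
    · by_contra hcon
      have n1 := not_imp_comm.1 (hl.reduces_of_not_outer 1 h1r h1i) hcon
      have n2 := fun h => hcon (reduces_of_oct _ hpr hpi (by omega) h)
      exact hcon (reduces_of_oct _ hmr hmi (by omega)
        (hoy.oct_sub_of_odd_odd hq hp hox hyp hxp (hno hyp) n1 n2))
  -- Here the conjugate of `x` lies in the octant of `y`; the signs are rewritten in terms of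
  -- `-x.im`.
  · have hox := hl.octant hx hx' (abs_of_nonpos hd) ((neg_le_abs _).trans hxo)
    rw [← sub_neg_eq_add] at hpr hir
    rw [sub_eq_add_neg y.im] at h1i hpi
    by_contra hcon
    rcases Int.emod_two_eq_zero_or_one (x.re + x.im) with hxp | hxp
    · have hyp : (y.re + y.im) % 2 = 1 := by omega
      have n1 := fun h => hcon (reduces_of_oct 1 h1r h1i (by omega) h)
      have n2 := fun h => hcon (reduces_of_oct _ hir hii (by omega) h)
      exact hcon (reduces_of_oct _ hpr hpi (by omega)
        (hoy.oct_sub_of_odd_even_opposite hq hp hox hyp (by omega) n1 n2))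
    rcases Int.emod_two_eq_zero_or_one (y.re + y.im) with hyp | hyp
    · have n1 := fun h => hcon (reduces_of_oct 1 h1r h1i (by omega) h)
      have n2 := fun h => hcon (reduces_of_oct _ hir hii (by omega) h)
      exact hcon (hl.reduces_of_not_outer _ hpr hpi
        (hoy.not_outer_sub_of_even_odd hq hp hox hyp (by omega) n1 n2))
    · have n1 := not_imp_comm.1 (hl.reduces_of_not_outer 1 h1r h1i) hcon
      have n2 := not_imp_comm.1 (hl.reduces_of_not_outer _ hir hii) hcon
      exact hcon (reduces_of_oct _ hpr hpi (by omega)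
        (hoy.oct_sub_of_odd_odd_opposite hq hp hox hyp (by omega) (hno hyp) n1 n2))

theorem exists_unit_octant (x : GaussianInt) :
    ∃ u v : GaussianInt, u * v = 1 ∧ |(u * x).im| ≤ (u * x).re ∧
      ∀ m : ℤ, (x.re + x.im) % 2 = m → ((u * x).re + (u * x).im) % 2 = m := by
  rcases abs_cases x.re with h1 | h1 <;> rcases abs_cases x.im with h2 | h2 <;>
    rcases le_total |x.re| |x.im| with h | h
  all_goals first
    | exact ⟨1, 1, by decide, by simp; omega, by simp⟩
    | exact ⟨-1, -1, by decide, by simp; omega, by simp; omega⟩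
    | exact ⟨⟨0, 1⟩, ⟨0, -1⟩, by decide, by simp; omega, by simp; omega⟩
    | exact ⟨⟨0, -1⟩, ⟨0, 1⟩, by decide, by simp; omega, by simp; omega⟩

theorem Inside.unit_mul {p q : ℤ} {u v x : GaussianInt} (huv : u * v = 1) :
    Inside p q (u * x) ↔ Inside p q x := by
  constructor <;> intro h
  · rw [mul_comm] at h
    exact h.of_mul
  · refine Inside.of_mul (z := v) ?_
    rwa [show u * x * v = x by linear_combination x * huv]

theorem inside_star_iff {p q : ℤ} {x : GaussianInt} : Inside p q (star x) ↔ Inside p q x :=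
  ⟨fun h => by simpa using inside_star h, inside_star⟩

/-- Divisor and dividend may be multiplied by units independently, but conjugation acts on both at
once. So `y` can be moved into one octant, `x` only into a quadrant made of two octants. -/
theorem IsLevel.reduces_of_not_both_even {p q : ℤ} (hl : IsLevel p q) {x y : GaussianInt}
    (hx : Inside q (2 * p) x) (hx' : ¬ Inside p q x)
    (hy : Inside q (2 * p) y) (hy' : ¬ Inside p q y)
    (hpar : (x.re + x.im) % 2 = 1 ∨ (y.re + y.im) % 2 = 1) : Reduces p q x y := by
  obtain ⟨u, u', hu, hux, hum⟩ := exists_unit_octant x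
  obtain ⟨v, v', hv, hvy, hvm⟩ := exists_unit_octant y
  refine Reduces.of_mul_left (u := u) (Reduces.of_mul_unit hv ?_)
  rw [← Inside.unit_mul hu] at hx hx'
  rw [← Inside.unit_mul hv] at hy hy'
  replace hpar := hpar.imp (hum 1) (hvm 1)
  generalize u * x = x at *
  generalize v * y = y at *
  rcases le_total 0 y.im with h | h
  · exact hl.reduces_of_octant hx hx' hux hy hy' h ((le_abs_self _).trans hvy) hpar
  · rw [← inside_star_iff] at hx hx' hy hy'
    refine Reduces.of_star (hl.reduces_of_octant hx hx' ?_ hy hy' ?_ ?_ ?_)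
    · simpa using hux
    · simpa using h
    · simpa using (neg_le_abs _).trans hvy
    · simp only [Zsqrtd.re_star, Zsqrtd.im_star]
      omega

theorem exists_onePlusI_mul_of_even {x : GaussianInt} (h : (x.re + x.im) % 2 = 0) :
    ∃ y, x = onePlusI * y := by
  refine ⟨⟨(x.re + x.im) / 2, (x.im - x.re) / 2⟩, Zsqrtd.ext ?_ ?_⟩
  · rw [re_onePlusI_mul]; simp only; omega
  · rw [im_onePlusI_mul]; simp only; omega

theorem IsLevel.reduces_onePlusI_mul {p q : ℤ} (hl : IsLevel p q) {x y : GaussianInt}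
    (h : Reduces p q x y) : Reduces q (2 * p) (onePlusI * x) (onePlusI * y) := by
  obtain ⟨r, hr, h⟩ := h
  refine ⟨onePlusI * r, by rw [← mul_sub]; exact mul_dvd_mul_left _ hr, ?_⟩
  exact h.imp (fun h => by rw [h, mul_zero]) hl.inside_onePlusI_mul

/-! ### Digit expansions in base `1 + i` -/

/-- The four units of the Gaussian integers and zero. -/
def IsDigit (v : GaussianInt) : Prop := v = 0 ∨ |v.re| + |v.im| = 1

/-- For a unit digit the sum is odd, so only the largest octagon matters. Its bounds exceed those
satisfied by `(1 + i) * r` by at least 1, the size of the digit. -/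
theorem IsLevel.inside_digit_add {p q : ℤ} (hl : IsLevel p q) {v r : GaussianInt} (hv : IsDigit v)
    (hr : r = 0 ∨ Inside p q r) :
    v + onePlusI * r = 0 ∨ Inside q (2 * p) (v + onePlusI * r) := by
  rcases hv with rfl | hv
  · rw [zero_add]
    exact hr.imp (fun h => by rw [h, mul_zero]) hl.inside_onePlusI_mul
  · right
    have hp := hl.pos
    have hq := hl.eq_or
    have ho : |r.re| + |r.im| ≤ 2 * p + q - 3 ∧ |r.re| ≤ p + q - 2 ∧ |r.im| ≤ p + q - 2 ∨
        |r.re| = 0 ∧ |r.im| = 0 := by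
      rcases hr with rfl | hr
      · exact Or.inr (by simp)
      · obtain ⟨h1, h2, h3⟩ := hr.oct
        exact Or.inl ⟨h3, h1, h2⟩
    refine inside_of_odd ?_ ⟨?_, ?_, ?_⟩ <;>
      simp only [Zsqrtd.re_add, Zsqrtd.im_add, re_onePlusI_mul, im_onePlusI_mul]
    · rcases abs_cases v.re with h | h <;> rcases abs_cases v.im with h' | h' <;> omega
    all_goals
      have := abs_sub_add_cases r.re r.im
      have := abs_add_le v.re (r.re - r.im)
      have := abs_add_le v.im (r.re + r.im)
      have := abs_nonneg v.re
      have := abs_nonneg v.im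
      have := abs_nonneg r.re
      have := abs_nonneg r.im
      omega

theorem norm_sub_le_of_sign (a b : ℤ) (h : (a + b) % 2 = 1) :
    ∃ c d : ℤ, |c| + |d| = 1 ∧ (a - c) ^ 2 + (b - d) ^ 2 ≤ a ^ 2 + b ^ 2 := by
  rcases lt_trichotomy a 0 with ha | rfl | ha
  · exact ⟨-1, 0, by norm_num, by nlinarith⟩
  · rcases lt_trichotomy b 0 with hb | rfl | hb
    · exact ⟨0, -1, by norm_num, by nlinarith⟩
    · omega
    · exact ⟨0, 1, by norm_num, by nlinarith⟩
  · exact ⟨1, 0, by norm_num, by nlinarith⟩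

/-- Digit expansion in base `1 + i`. -/
theorem exists_digit_add (a : GaussianInt) (ha : a ≠ 0) :
    ∃ v b : GaussianInt, IsDigit v ∧ a = v + onePlusI * b ∧ b.norm.natAbs < a.norm.natAbs := by
  obtain ⟨v, hv, hpar, hle⟩ : ∃ v : GaussianInt, IsDigit v ∧
      ((a - v).re + (a - v).im) % 2 = 0 ∧ (a - v).norm ≤ a.norm := by
    rcases Int.emod_two_eq_zero_or_one (a.re + a.im) with h | h
    · exact ⟨0, Or.inl rfl, by simpa using h, by simp⟩
    · obtain ⟨c, d, hcd, hle⟩ := norm_sub_le_of_sign a.re a.im h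
      refine ⟨⟨c, d⟩, Or.inr hcd, ?_, ?_⟩
      · simp only [Zsqrtd.re_sub, Zsqrtd.im_sub]
        rcases abs_cases c with h | h <;> rcases abs_cases d with h' | h' <;> omega
      · simp only [Zsqrtd.norm_def, Zsqrtd.re_sub, Zsqrtd.im_sub]
        nlinarith
  obtain ⟨b, hb⟩ := exists_onePlusI_mul_of_even hpar
  refine ⟨v, b, hv, by rw [← hb]; ring, ?_⟩
  have hnorm : (a - v).norm = 2 * b.norm := by
    rw [hb, Zsqrtd.norm_mul]
    rfl
  have h0 : 0 ≤ b.norm := GaussianInt.norm_nonneg b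
  have hpos : 0 < a.norm := GaussianInt.norm_pos.2 ha
  omega

/-- Induction on the norm: write `a = v + (1 + i) * b`, replace `b` by its representative `r` in the
lower level, and note that `v + (1 + i) * r` is zero or in the next level. -/
theorem IsLevel.reduces_of_reduces_inside {p q : ℤ} (hl : IsLevel p q) {x : GaussianInt}
    (h : ∀ y, Inside q (2 * p) y → Reduces p q x y) (a : GaussianInt) : Reduces p q x a := by
  induction hn : a.norm.natAbs using Nat.strong_induction_on generalizing a with
  | _ n ih =>
    subst hn
    by_cases ha : a = 0
    · subst ha
      exact ⟨0, by simp, Or.inl rfl⟩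
    obtain ⟨v, b, hv, rfl, hlt⟩ := exists_digit_add a ha
    obtain ⟨r, hr, hr'⟩ := ih _ hlt b rfl
    have hstep : x ∣ v + onePlusI * b - (v + onePlusI * r) := by
      rw [show v + onePlusI * b - (v + onePlusI * r) = onePlusI * (b - r) by ring]
      exact hr.mul_left _
    rcases hl.inside_digit_add hv hr' with h0 | hin
    · rw [h0] at hstep
      exact ⟨0, hstep, Or.inl rfl⟩
    · obtain ⟨s, hs, hs'⟩ := h _ hin
      exact ⟨s, by rw [← sub_add_sub_cancel]; exact dvd_add hstep hs, hs'⟩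

/-! ### The minimal Euclidean function -/

/-- The parameters of the `n`-th level. -/
def levelParams : ℕ → ℤ × ℤ
  | 0 => (1, 1)
  | n + 1 => ((levelParams n).2, 2 * (levelParams n).1)

/-- The nonzero Gaussian integers whose minimal Euclidean value is less than `n`. -/
def ball (n : ℕ) (x : GaussianInt) : Prop := Inside (levelParams n).1 (levelParams n).2 x

theorem isLevel_levelParams (n : ℕ) : IsLevel (levelParams n).1 (levelParams n).2 := by
  induction n with
  | zero => exact ⟨0, rfl, Or.inl rfl⟩
  | succ n ih => exact ih.next

theorem not_ball_zero (x : GaussianInt) : ¬ ball 0 x := by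
  intro h
  obtain ⟨h1, h2, -⟩ := h.oct
  refine h.ne_zero (Zsqrtd.ext ?_ ?_)
  · exact abs_eq_zero.1 (le_antisymm (by simpa [levelParams] using h1) (abs_nonneg _))
  · exact abs_eq_zero.1 (le_antisymm (by simpa [levelParams] using h2) (abs_nonneg _))

theorem ball_succ {n : ℕ} {x : GaussianInt} (h : ball n x) : ball (n + 1) x :=
  (isLevel_levelParams n).inside_next h

theorem ball_mono {m n : ℕ} (hmn : m ≤ n) {x : GaussianInt} (h : ball m x) : ball n x := by
  induction hmn with
  | refl => exact h
  | step _ ih => exact ball_succ ih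

/-- Every class modulo an element of `ball (n + 1)` meets `ball n` or contains zero. -/
theorem reduces_of_ball (n : ℕ) {x : GaussianInt} (hx : ball (n + 1) x) (a : GaussianInt) :
    Reduces (levelParams n).1 (levelParams n).2 x a := by
  induction n generalizing x a with
  | zero =>
    refine (isLevel_levelParams 0).reduces_of_reduces_inside (fun y hy => ?_) a
    refine (isLevel_levelParams 0).reduces_of_not_both_even hx (not_ball_zero x) hy
      (not_ball_zero y) ?_
    -- If `x` were even, cancelling `1 + i` would give an element of the empty `ball 0`.
    by_contra! hcon
    obtain ⟨z, rfl⟩ := exists_onePlusI_mul_of_even (x := x) (by omega)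
    exact not_ball_zero z ((isLevel_levelParams 0).inside_of_onePlusI_mul hx)
  | succ n ih =>
    have hl := isLevel_levelParams (n + 1)
    refine hl.reduces_of_reduces_inside (fun y hy => ?_) a
    by_cases hx' : ball (n + 1) x
    · obtain ⟨r, hr, hr'⟩ := ih hx' y
      exact ⟨r, hr, hr'.imp id ball_succ⟩
    by_cases hy' : ball (n + 1) y
    · exact ⟨y, by simp, Or.inr hy'⟩
    by_cases hpar : (x.re + x.im) % 2 = 1 ∨ (y.re + y.im) % 2 = 1
    · exact hl.reduces_of_not_both_even hx hx' hy hy' hpar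
    · obtain ⟨z, rfl⟩ := exists_onePlusI_mul_of_even (x := x) (by omega)
      obtain ⟨w, rfl⟩ := exists_onePlusI_mul_of_even (x := y) (by omega)
      exact (isLevel_levelParams n).reduces_onePlusI_mul (ih (hl.inside_of_onePlusI_mul hx) w)

/-- A class modulo `x` that can only be represented in `Inside p q` or by zero if `x` lies in the
next level. -/
theorem IsLevel.exists_inside_sub {p q : ℤ} (hl : IsLevel p q) :
    ∃ z : GaussianInt, ∀ r, r = 0 ∨ Inside p q r → r ≠ z ∧ Inside q (2 * p) (z - r) := by
  have hp := hl.pos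
  have hl' := hl
  obtain ⟨k, hk, hq⟩ := hl
  have hpow : ∀ j, (2 : ℤ) ^ j < 2 * p → (2 : ℤ) ^ (j + 1) ∣ p ∨ j = k := by
    intro j hj
    rw [hk, ← pow_succ'] at hj
    have := (pow_lt_pow_iff_right₀ (by norm_num : (1 : ℤ) < 2)).1 hj
    rcases Nat.lt_or_ge j k with h | h
    · left; rw [hk]; exact pow_dvd_pow 2 h
    · right; omega
  have hnd : ¬ (2 : ℤ) ^ (k + 1) ∣ p := by
    intro h
    have := Int.le_of_dvd hp h
    rw [pow_succ, ← hk] at this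
    linarith
  rcases hq with rfl | rfl
  -- From `(p, q)` to `(q, 2p)` the bound on coordinates grows by `p` and the bound on the sum by
  -- `q`. The witness uses up exactly this growth: `q` when `q = p`, and `p + pi` when `q = 2p`.
  · refine ⟨⟨q, 0⟩, fun r hr => ?_⟩
    rcases hr with rfl | hr
    · refine ⟨fun h => hp.ne (congrArg Zsqrtd.re h), k, ?_, ?_⟩
      · rw [Zsqrtd.intCast_dvd]
        simpa using hnd
      · rw [← hk]
        simp only [sub_zero]
        refine ⟨?_, ?_, ?_⟩ <;> simp [abs_of_pos hp] <;> linarith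
    · have hr0 := hr.ne_zero
      obtain ⟨j, hj, h1, h2, h3⟩ := hr
      have ht : (0 : ℤ) < 2 ^ j := by positivity
      have hdiv : (2 : ℤ) ^ (j + 1) ∣ q := by
        -- For `j = k` the octagon would shrink to the origin.
        refine (hpow j (by linarith [abs_nonneg r.re])).resolve_right ?_
        rintro rfl
        refine hr0 (Zsqrtd.ext (abs_eq_zero.1 ?_) (abs_eq_zero.1 ?_))
        · exact le_antisymm (by linarith) (abs_nonneg _)
        · exact le_antisymm (by linarith) (abs_nonneg _)
      rw [Zsqrtd.intCast_dvd] at hj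
      refine ⟨fun h => hj ?_, j, ?_, ?_⟩
      · rw [h]; exact ⟨hdiv, dvd_zero _⟩
      · rw [Zsqrtd.intCast_dvd]
        simpa [dvd_sub_right hdiv] using hj
      · have := abs_sub q r.re
        rw [abs_of_pos hp] at this
        refine ⟨?_, ?_, ?_⟩ <;> simp only [Zsqrtd.re_sub, Zsqrtd.im_sub, zero_sub, abs_neg] <;>
          linarith
  · refine ⟨⟨p, p⟩, fun r hr => ?_⟩
    rcases hr with rfl | hr
    · refine ⟨fun h => hp.ne (congrArg Zsqrtd.re h), k, ?_, ?_⟩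
      · rw [Zsqrtd.intCast_dvd]
        simpa using hnd
      · rw [← hk]
        simp only [sub_zero]
        refine ⟨?_, ?_, ?_⟩ <;> simp [abs_of_pos hp] <;> linarith
    · obtain ⟨j, hj, h1, h2, h3⟩ := hr
      have ht : (0 : ℤ) < 2 ^ j := by positivity
      rw [Zsqrtd.intCast_dvd] at hj
      have hA := abs_nonneg r.re
      have hB := abs_nonneg r.im
      have hoct : Oct (2 * p + 2 * p - 2 * 2 ^ j) (2 * (2 * p) + 2 * p - 3 * 2 ^ j)
          (p - r.re) (p - r.im) := by
        have e1 := abs_sub p r.re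
        have e2 := abs_sub p r.im
        rw [abs_of_pos hp] at e1 e2
        exact ⟨by linarith, by linarith, by linarith⟩
      refine ⟨?_, j, ?_, hoct⟩
      · rintro rfl
        rw [abs_of_pos hp] at h1 h3
        rcases hpow j (by linarith) with h | rfl
        · exact hj ⟨h, h⟩
        · linarith
      · rw [Zsqrtd.intCast_dvd]
        simp only [Zsqrtd.re_sub, Zsqrtd.im_sub]
        rcases hpow j (by linarith) with h | rfl
        · rwa [dvd_sub_right h, dvd_sub_right h]
        · rintro ⟨⟨a, ha⟩, ⟨b, hb⟩⟩
          rw [pow_succ, ← hk] at ha hb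
          rw [← hk] at h1 h2 h3
          -- For `j = k`, divisibility of `z - r` by `2p` would force both coordinates of `r` to be
          -- at least `p` in size, while their sum is at most `p`.
          have hne : ∀ c s : ℤ, p - s = p * 2 * c → p ≤ |s| := by
            intro c s hs
            obtain rfl : s = p * (1 - 2 * c) := by linarith
            rw [abs_mul, abs_of_pos hp]
            have : 1 ≤ |1 - 2 * c| := Int.one_le_abs (by omega)
            nlinarith
          linarith [hne a _ ha, hne b _ hb]

/-- Every Euclidean function is at least the level. -/
theorem IsEuclideanFunction.ball_succ {f : GaussianInt → ℕ}
    (hf : IsEuclideanFunction GaussianInt f) {x : GaussianInt} (hx : x ≠ 0) : ball (f x + 1) x := by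
  induction hn : f x using Nat.strong_induction_on generalizing x with
  | _ n ih =>
    subst hn
    obtain ⟨z, hz⟩ := (isLevel_levelParams (f x)).exists_inside_sub
    obtain ⟨w, r, hwr, hr⟩ := hf z x hx
    have hr' : r = 0 ∨ ball (f x) r := by
      by_cases h0 : r = 0
      · exact Or.inl h0
      · have hlt := hr.resolve_left h0
        exact Or.inr (ball_mono hlt (ih _ hlt h0 rfl))
    obtain ⟨-, h⟩ := hz r hr'
    rw [show z - r = x * w by rw [hwr]; ring] at h
    exact h.of_mul

/-- The lower bound applies to the minimal function because it is itself Euclidean. Conversely, the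
level of an element defines a Euclidean function, so it dominates the minimal one. -/
theorem minimalEuclideanFunction_le_iff {n : ℕ} {x : GaussianInt} :
    minimalEuclideanFunction GaussianInt x ≤ n ↔ x = 0 ∨ ball (n + 1) x := by
  have hleast := isLeast_minimalEuclideanFunction GaussianInt _ isEuclideanFunction_norm_gaussianInt
  constructor
  · intro h
    by_cases hx : x = 0
    · exact Or.inl hx
    · exact Or.inr (ball_mono (by omega) (IsEuclideanFunction.ball_succ hleast.1 hx))
  · classical
    let g : GaussianInt → ℕ := fun x => sInf {n | x = 0 ∨ ball (n + 1) x}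
    have hne : ∀ x, {n | x = 0 ∨ ball (n + 1) x}.Nonempty := by
      intro x
      by_cases hx : x = 0
      · exact ⟨0, Or.inl hx⟩
      · exact ⟨_, Or.inr (IsEuclideanFunction.ball_succ hleast.1 hx)⟩
    have hg : IsEuclideanFunction GaussianInt g := by
      intro a b hb
      have hmem : b = 0 ∨ ball (g b + 1) b := Nat.sInf_mem (hne b)
      obtain ⟨r, ⟨w, hw⟩, hr⟩ := reduces_of_ball (g b) (hmem.resolve_left hb) a
      refine ⟨w, r, by linear_combination hw, hr.imp id fun hr => ?_⟩
      -- At value 0 the remainder must vanish, since `ball 0` is empty.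
      rcases hgb : g b with _ | m
      · rw [hgb] at hr
        exact absurd hr (not_ball_zero r)
      · rw [hgb] at hr
        exact Nat.lt_succ_of_le (Nat.sInf_le (Or.inr hr))
    exact fun h => (hleast.2 hg x).trans (Nat.sInf_le h)

/-! ### Counting lattice points -/

theorem levelParams_two_mul_add_one (k : ℕ) : levelParams (2 * k + 1) = (2 ^ k, 2 * 2 ^ k) := by
  induction k with
  | zero => rfl
  | succ k ih =>
    rw [show 2 * (k + 1) + 1 = 2 * k + 1 + 1 + 1 by ring, levelParams, levelParams, ih]
    simp [pow_succ']

theorem sum_Icc_neg_natAbs (f : ℕ → ℤ) (m : ℕ) :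
    ∑ a ∈ Finset.Icc (-m : ℤ) m, f a.natAbs = f 0 + 2 * ∑ i ∈ Finset.range m, f (i + 1) := by
  induction m with
  | zero => simp
  | succ m ih =>
    have h : Finset.Icc (-(m + 1 : ℕ) : ℤ) (m + 1 : ℕ) =
        insert (-(m + 1 : ℤ)) (insert (m + 1 : ℤ) (Finset.Icc (-m : ℤ) m)) := by
      ext a
      simp only [Finset.mem_Icc, Finset.mem_insert]
      omega
    rw [h, Finset.sum_insert, Finset.sum_insert, ih, Finset.sum_range_succ]
    · rw [Int.natAbs_neg, show ((m : ℤ) + 1).natAbs = m + 1 by omega]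
      ring
    · simp
    · simp only [Finset.mem_Icc, Finset.mem_insert]
      omega

theorem sum_range_min (e d n : ℕ) (hn : n ≤ d) :
    ∑ i ∈ Finset.range (e + n), (2 * min (e + d : ℤ) (2 * e + d - ((i + 1 : ℕ) : ℤ)) + 1) =
      e * (2 * (e + d) + 1) + 2 * (e + d) * n - n ^ 2 := by
  induction n with
  | zero =>
    have h : ∀ i ∈ Finset.range e,
        2 * min (e + d : ℤ) (2 * e + d - ((i + 1 : ℕ) : ℤ)) + 1 = 2 * (e + d) + 1 := by
      intro i hi
      rw [Finset.mem_range] at hi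
      rw [min_eq_left (by omega)]
    rw [add_zero, Finset.sum_congr rfl h]
    simp
  | succ n ih =>
    rw [← add_assoc, Finset.sum_range_succ, ih (by omega), min_eq_right (by omega)]
    push_cast
    ring

/-- The octagon as a finite set. -/
noncomputable def octFinset (m s : ℤ) : Finset (ℤ × ℤ) :=
  (Finset.Icc (-m) m ×ˢ Finset.Icc (-m) m).filter fun x => |x.1| + |x.2| ≤ s

theorem mem_octFinset {m s : ℤ} {x : ℤ × ℤ} : x ∈ octFinset m s ↔ Oct m s x.1 x.2 := by
  simp [octFinset, Oct, abs_le, and_assoc]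

/-- The octagon is a square of side `2(e + d) + 1` without four corner triangles of `d(d + 1)/2`
points each. The count is by columns: those with `|a| ≤ e` have full height, then each shrinks by 2.
-/
theorem card_octFinset (e d : ℕ) :
    ((octFinset (e + d) (2 * e + d)).card : ℤ) = (2 * (e + d) + 1) ^ 2 - 2 * (d * (d + 1)) := by
  have hfib : ∀ a ∈ Finset.Icc (-(e + d : ℕ) : ℤ) (e + d : ℕ),
      (((octFinset (e + d) (2 * e + d)).filter fun x => x.1 = a).card : ℤ) =
        2 * min (e + d : ℤ) (2 * e + d - (a.natAbs : ℤ)) + 1 := by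
    intro a ha
    rw [Finset.mem_Icc] at ha
    have : (octFinset (e + d) (2 * e + d)).filter (fun x => x.1 = a) =
        (Finset.Icc (-(min (e + d : ℤ) (2 * e + d - (a.natAbs : ℤ))))
          (min (e + d : ℤ) (2 * e + d - (a.natAbs : ℤ)))).map
            ⟨fun b => (a, b), fun b c h => by simpa using h⟩ := by
      ext ⟨x, y⟩
      simp only [Finset.mem_filter, mem_octFinset, Oct, Finset.mem_map, Finset.mem_Icc,
        Int.abs_eq_natAbs]
      constructor
      · rintro ⟨⟨h1, h2, h3⟩, rfl⟩
        exact ⟨y, by omega, rfl⟩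
      · rintro ⟨b, hb, h⟩
        cases h
        omega
    rw [this, Finset.card_map, Int.card_Icc]
    omega
  rw [Finset.card_eq_sum_card_fiberwise (f := Prod.fst)
    (t := Finset.Icc (-(e + d : ℕ) : ℤ) (e + d : ℕ))]
  · rw [Nat.cast_sum, Finset.sum_congr rfl hfib,
      sum_Icc_neg_natAbs (fun i => 2 * min (e + d : ℤ) (2 * e + d - (i : ℤ)) + 1),
      sum_range_min e d d le_rfl]
    rw [min_eq_left (by push_cast; omega)]
    ring
  · intro x hx
    rw [Finset.mem_coe, mem_octFinset, Oct, abs_le] at hx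
    rw [Finset.mem_coe, Finset.mem_Icc]
    omega

/-- The coordinates of a Gaussian integer. -/
def toProd (x : GaussianInt) : ℤ × ℤ := (x.re, x.im)

theorem toProd_injective : Function.Injective toProd := fun _ _ h =>
  Zsqrtd.ext (congrArg Prod.fst h) (congrArg Prod.snd h)

theorem card_oct (e d : ℕ) :
    {x : GaussianInt | Oct (e + d) (2 * e + d) x.re x.im}.Finite ∧
    ({x : GaussianInt | Oct (e + d) (2 * e + d) x.re x.im}.ncard : ℤ) =
      (2 * (e + d) + 1) ^ 2 - 2 * (d * (d + 1)) := by
  have himg : toProd '' {x : GaussianInt | Oct (e + d) (2 * e + d) x.re x.im} =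
      octFinset (e + d) (2 * e + d) := by
    ext ⟨a, b⟩
    rw [Finset.mem_coe, mem_octFinset]
    exact ⟨by rintro ⟨x, hx, h⟩; cases h; exact hx, fun h => ⟨⟨a, b⟩, h, rfl⟩⟩
  refine ⟨Set.Finite.of_finite_image (himg ▸ Finset.finite_toSet _) toProd_injective.injOn, ?_⟩
  rw [← Set.ncard_image_of_injective _ toProd_injective, himg, Set.ncard_coe_finset, card_octFinset]

theorem inside_two_mul_iff {p q : ℤ} {x : GaussianInt} :
    Inside (2 * p) (2 * q) (2 * x) ↔ Inside p q x := by
  have hre : (2 * x).re = 2 * x.re := by simp [two_mul]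
  have him : (2 * x).im = 2 * x.im := by simp [two_mul]
  constructor
  · rintro ⟨j, hj, ho⟩
    rw [Zsqrtd.intCast_dvd, hre, him] at hj
    rcases j with _ | j
    · simp at hj
    · refine ⟨j, ?_, ?_⟩
      · rw [Zsqrtd.intCast_dvd]
        rw [pow_succ', mul_dvd_mul_iff_left two_ne_zero, mul_dvd_mul_iff_left two_ne_zero] at hj
        exact hj
      · rw [hre, him, pow_succ'] at ho
        simp only [Oct, abs_mul, abs_two] at ho ⊢
        omega
  · rintro ⟨j, hj, ho⟩
    rw [Zsqrtd.intCast_dvd] at hj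
    refine ⟨j + 1, ?_, ?_⟩
    · rw [Zsqrtd.intCast_dvd, hre, him, pow_succ', mul_dvd_mul_iff_left two_ne_zero,
        mul_dvd_mul_iff_left two_ne_zero]
      exact hj
    · rw [hre, him, pow_succ']
      simp only [Oct, abs_mul, abs_two] at ho ⊢
      omega

theorem inside_iff_of_not_two_dvd {p q : ℤ} {x : GaussianInt} (h : ¬ 2 ∣ x) :
    Inside p q x ↔ Oct (p + q - 2) (2 * p + q - 3) x.re x.im :=
  ⟨Inside.oct, fun ho => ⟨0, by simpa using h, by simpa using ho⟩⟩

theorem ncard_image_two_mul (s : Set GaussianInt) : ((2 * ·) '' s).ncard = s.ncard :=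
  Set.ncard_image_of_injective s (mul_right_injective₀ two_ne_zero)

theorem disjoint_two_mul (s : Set GaussianInt) (P : GaussianInt → Prop) :
    Disjoint ((2 * ·) '' s) {x | ¬ 2 ∣ x ∧ P x} := by
  rw [Set.disjoint_left]
  rintro _ ⟨x, -, rfl⟩ ⟨h, -⟩
  exact h (dvd_mul_right 2 x)

/-- The multiples of 2 in the octagon are the doubled points of an octagon of half the size, so the
count is a difference of two octagon counts. -/
theorem card_not_two_dvd_oct (h : ℕ) (hh : 1 ≤ h) :
    {x : GaussianInt | ¬ 2 ∣ x ∧ Oct (6 * h - 2) (8 * h - 3) x.re x.im}.Finite ∧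
    ({x : GaussianInt | ¬ 2 ∣ x ∧ Oct (6 * h - 2) (8 * h - 3) x.re x.im}.ncard : ℤ) =
      84 * h ^ 2 - 48 * h + 8 := by
  obtain ⟨n, rfl⟩ := Nat.exists_eq_add_of_le' hh
  obtain ⟨hf, hc⟩ := card_oct (2 * n + 1) (4 * n + 3)
  obtain ⟨hf', hc'⟩ := card_oct n (2 * n + 2)
  have hset : {x : GaussianInt | Oct ((2 * n + 1 : ℕ) + (4 * n + 3 : ℕ))
      (2 * (2 * n + 1 : ℕ) + (4 * n + 3 : ℕ)) x.re x.im} =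
      (2 * ·) '' {x : GaussianInt | Oct (n + (2 * n + 2 : ℕ)) (2 * n + (2 * n + 2 : ℕ)) x.re x.im} ∪
      {x : GaussianInt | ¬ 2 ∣ x ∧
        Oct (6 * (n + 1 : ℕ) - 2) (8 * (n + 1 : ℕ) - 3) x.re x.im} := by
    have key : ∀ x : GaussianInt, Oct ((2 * n + 1 : ℕ) + (4 * n + 3 : ℕ))
        (2 * (2 * n + 1 : ℕ) + (4 * n + 3 : ℕ)) (2 * x).re (2 * x).im ↔
        Oct (n + (2 * n + 2 : ℕ)) (2 * n + (2 * n + 2 : ℕ)) x.re x.im := by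
      intro x
      rw [show (2 * x).re = 2 * x.re by simp [two_mul], show (2 * x).im = 2 * x.im by simp [two_mul]]
      simp only [Oct, abs_mul, abs_two]
      omega
    have e1 : ((2 * n + 1 : ℕ) + (4 * n + 3 : ℕ) : ℤ) = 6 * (n + 1 : ℕ) - 2 := by push_cast; ring
    have e2 : (2 * (2 * n + 1 : ℕ) + (4 * n + 3 : ℕ) : ℤ) = 8 * (n + 1 : ℕ) - 3 := by
      push_cast; ring
    ext x
    constructor
    · intro hx
      by_cases hd : 2 ∣ x
      · obtain ⟨y, rfl⟩ := hd
        exact Or.inl ⟨y, (key y).1 hx, rfl⟩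
      · refine Or.inr ⟨hd, ?_⟩
        rw [← e1, ← e2]
        exact hx
    · rintro (⟨y, hy, rfl⟩ | ⟨-, hx⟩)
      · exact (key y).2 hy
      · rw [← e1, ← e2] at hx
        exact hx
  have hf2 := hf.subset (hset ▸ Set.subset_union_right)
  refine ⟨hf2, ?_⟩
  have := Set.ncard_union_eq (disjoint_two_mul _ _) (hf'.image _) hf2
  rw [← hset, ncard_image_two_mul] at this
  replace this := (congrArg (Nat.cast : ℕ → ℤ) this).trans (Nat.cast_add _ _)
  rw [hc, hc'] at this
  push_cast at this ⊢
  linear_combination -this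

theorem zero_or_inside_one_two (x : GaussianInt) :
    x = 0 ∨ Inside 1 2 x ↔ Oct 1 1 x.re x.im := by
  constructor
  · rintro (rfl | h)
    · simp [Oct]
    · simpa using h.oct
  · intro h
    refine or_iff_not_imp_left.2 fun hx => inside_of_odd ?_ (by simpa using h)
    have hne : x.re ≠ 0 ∨ x.im ≠ 0 := by
      by_contra! hcon
      exact hx (Zsqrtd.ext hcon.1 hcon.2)
    simp only [Oct, Int.abs_eq_natAbs] at h
    omega

theorem card_zero_or_inside (k : ℕ) :
    {x : GaussianInt | x = 0 ∨ Inside (2 ^ k) (2 * 2 ^ k) x}.Finite ∧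
    ({x : GaussianInt | x = 0 ∨ Inside (2 ^ k) (2 * 2 ^ k) x}.ncard : ℤ) =
      25 + 8 * (k : ℤ) - 48 * 2 ^ k + 28 * 4 ^ k := by
  induction k with
  | zero =>
    -- Zero and the four units.
    simpa [zero_or_inside_one_two] using card_oct 0 1
  | succ k ih =>
    obtain ⟨hf, hc⟩ := ih
    obtain ⟨hf', hc'⟩ := card_not_two_dvd_oct (2 ^ k) Nat.one_le_two_pow
    have hset : {x : GaussianInt | x = 0 ∨ Inside (2 ^ (k + 1)) (2 * 2 ^ (k + 1)) x} =
        (2 * ·) '' {x : GaussianInt | x = 0 ∨ Inside (2 ^ k) (2 * 2 ^ k) x} ∪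
        {x : GaussianInt | ¬ 2 ∣ x ∧
          Oct (6 * (2 ^ k : ℕ) - 2) (8 * (2 ^ k : ℕ) - 3) x.re x.im} := by
      have e1 : (6 * (2 ^ k : ℕ) - 2 : ℤ) = 2 ^ (k + 1) + 2 * 2 ^ (k + 1) - 2 := by
        push_cast; ring
      have e2 : (8 * (2 ^ k : ℕ) - 3 : ℤ) = 2 * 2 ^ (k + 1) + 2 * 2 ^ (k + 1) - 3 := by
        push_cast; ring
      rw [e1, e2]
      ext x
      by_cases hd : 2 ∣ x
      · obtain ⟨y, rfl⟩ := hd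
        have hi : Inside (2 ^ (k + 1)) (2 * 2 ^ (k + 1)) (2 * y) ↔
            Inside (2 ^ k) (2 * 2 ^ k) y := by
          rw [pow_succ', inside_two_mul_iff]
        constructor
        · rintro (h | h)
          · exact Or.inl ⟨y, Or.inl ((mul_eq_zero.1 h).resolve_left two_ne_zero), rfl⟩
          · exact Or.inl ⟨y, Or.inr (hi.1 h), rfl⟩
        · rintro (⟨z, hz, h⟩ | ⟨h, -⟩)
          · obtain rfl := mul_right_injective₀ two_ne_zero h
            exact hz.imp (fun h => by rw [h, mul_zero]) hi.2
          · exact absurd (dvd_mul_right 2 y) h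
      · constructor
        · rintro (rfl | h)
          · exact absurd (dvd_zero 2) hd
          · exact Or.inr ⟨hd, (inside_iff_of_not_two_dvd hd).1 h⟩
        · rintro (⟨z, -, rfl⟩ | ⟨-, h⟩)
          · exact absurd (dvd_mul_right 2 z) hd
          · exact Or.inr ((inside_iff_of_not_two_dvd hd).2 h)
    rw [hset]
    refine ⟨(hf.image _).union hf', ?_⟩
    rw [Set.ncard_union_eq (disjoint_two_mul _ _) (hf.image _) hf', ncard_image_two_mul]
    push_cast at hc' ⊢
    have h4 : (4 : ℤ) ^ k = (2 ^ k) ^ 2 := by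
      rw [← pow_mul, mul_comm k, pow_mul]
      norm_num
    rw [hc, hc', pow_succ (4 : ℤ), h4]
    ring

theorem mainTheorem1 (k : ℕ) (hk : 1 ≤ k) :
    (minimalEuclideanFunction GaussianInt ⁻¹' Set.Icc 0 (2 * k)).Finite ∧
      ((minimalEuclideanFunction GaussianInt ⁻¹' Set.Icc 0 (2 * k)).ncard : ℤ) =
        25 + 8 * (k : ℤ) - 48 * 2 ^ k + 28 * 4 ^ k := by
  have h : minimalEuclideanFunction GaussianInt ⁻¹' Set.Icc 0 (2 * k) =
      {x : GaussianInt | x = 0 ∨ Inside (2 ^ k) (2 * 2 ^ k) x} := by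
    ext x
    rw [Set.mem_preimage, Set.mem_Icc, Set.mem_ofPred_eq, minimalEuclideanFunction_le_iff, ball,
      levelParams_two_mul_add_one]
    simp
  rw [h]
  exact card_zero_or_inside k
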